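/- For a real $m\times n$ matrix $B$ and $1\le j\le m$, the $j$-th leverage score of $B$ is $\|e_j^TQ\|_2^2$, where $Q$ is any matrix whose columns form an orthonormal basis of the column space of $B$ (the value does not depend on $Q$). Let $\|\cdot\|_2$ denote the spectral norm, $B^\dagger$ the Moore--Penrose inverse, and $\kappa_2(B)=\|B\|_2\|B^\dagger\|_2$. Theorem. Let $A$ and $\Delta A$ be real $m\times n$ matrices with $\operatorname{rank}(A)=n$ and $\|\Delta A\|_2\,\|A^\dagger\|_2\le 1/2$. Then $\operatorname{rank}(A+\Delta A)=n$. Let $\ell_j$ and $\tilde\ell_j$ be the leverage scores of $A$ and $A+\Delta A$, respectively. For every $1\le j\le m$ with $\ell_j>0$, $$\frac{|\tilde\ell_j-\ell_j|}{\ell_j}\le 4\left(\sqrt{\frac{1-\ell_j}{\ell_j}}+\frac{\kappa_2(A)}{\ell_j}\,\epsilon^\perp\right)\kappa_2(A)\,\epsilon^\perp,\qquad \epsilon^\perp=\frac{\|(I_m-AA^\dagger)\Delta A\|_2}{\|A\|_2},$$ and $$\frac{|\tilde\ell_j-\ell_j|}{\ell_j}\le \left(2\sqrt{\frac{1-\ell_j}{\ell_j}}+\frac{\kappa_2(A)}{\ell_j}\,\epsilon\right)\kappa_2(A)\,\epsilon,\qquad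 \epsilon=\frac{\|\Delta A\|_2}{\|A\|_2}.$$ -/

import Mathlib

open scoped Matrix Matrix.Norms.L2Operator

noncomputable section

/-- `X` satisfies the four Penrose equations for the real matrix `A`. -/
structure IsMoorePenroseInverse {m n : ℕ} (A : Matrix (Fin m) (Fin n) ℝ)
    (X : Matrix (Fin n) (Fin m) ℝ) : Prop where
  mul_mul_self : A * X * A = A
  inv_mul_mul : X * A * X = X
  symm_left : (A * X)ᵀ = A * X
  symm_right : (X * A)ᵀ = X * A

/-- A symmetric real matrix has a symmetric Moore-Penrose inverse commuting with it
(invert the nonzero eigenvalues). -/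
theorem exists_symm_pseudoInverse {n : ℕ} (M : Matrix (Fin n) (Fin n) ℝ) (hM : Mᵀ = M) :
    ∃ N : Matrix (Fin n) (Fin n) ℝ, Nᵀ = N ∧ (N * M)ᵀ = N * M ∧ N * M * N = N ∧
      M * N * M = M := by
  have hH : M.IsHermitian := by
    rw [Matrix.IsHermitian, Matrix.conjTranspose_eq_transpose_of_trivial, hM]
  obtain ⟨U, d, hU, hMd⟩ : ∃ (U : Matrix (Fin n) (Fin n) ℝ) (d : Fin n → ℝ),
      Uᵀ * U = 1 ∧ M = U * Matrix.diagonal d * Uᵀ := by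
    refine ⟨hH.eigenvectorUnitary, hH.eigenvalues, ?_, ?_⟩
    · have := Unitary.coe_star_mul_self hH.eigenvectorUnitary
      rwa [Matrix.star_eq_conjTranspose, Matrix.conjTranspose_eq_transpose_of_trivial] at this
    · have := hH.spectral_theorem
      rw [Unitary.conjStarAlgAut_apply] at this
      rw [Matrix.star_eq_conjTranspose, Matrix.conjTranspose_eq_transpose_of_trivial] at this
      exact this
  have key : ∀ a b : Fin n → ℝ, (U * Matrix.diagonal a * Uᵀ) * (U * Matrix.diagonal b * Uᵀ)
      = U * Matrix.diagonal (fun i => a i * b i) * Uᵀ := by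
    intro a b
    calc (U * Matrix.diagonal a * Uᵀ) * (U * Matrix.diagonal b * Uᵀ)
        = U * Matrix.diagonal a * (Uᵀ * U) * Matrix.diagonal b * Uᵀ := by
          simp only [Matrix.mul_assoc]
      _ = _ := by rw [hU, Matrix.mul_one, Matrix.mul_assoc U, Matrix.diagonal_mul_diagonal]
  have ksymm : ∀ a : Fin n → ℝ, (U * Matrix.diagonal a * Uᵀ)ᵀ = U * Matrix.diagonal a * Uᵀ := by
    intro a
    simp [Matrix.transpose_mul, Matrix.mul_assoc]
  refine ⟨U * Matrix.diagonal (fun i => (d i)⁻¹) * Uᵀ, ksymm _, ?_, ?_, ?_⟩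
  · rw [hMd, key, ksymm]
  · rw [hMd, key, key]
    congr 3
    funext i
    by_cases h : d i = 0 <;> simp [h]
  · rw [hMd, key, key]
    congr 3
    funext i
    by_cases h : d i = 0 <;> simp [h]

/-- Every real matrix has a Moore-Penrose inverse. -/
theorem exists_isMoorePenroseInverse {m n : ℕ} (A : Matrix (Fin m) (Fin n) ℝ) :
    ∃ X, IsMoorePenroseInverse A X := by
  obtain ⟨N, hN, hNM, hNMN, hMNM⟩ := exists_symm_pseudoInverse (Aᵀ * A)
    (by rw [Matrix.transpose_mul, Matrix.transpose_transpose])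
  have hz : A - A * (N * (Aᵀ * A)) = 0 := by
    have h0 : (A - A * (N * (Aᵀ * A)))ᵀ * (A - A * (N * (Aᵀ * A))) = 0 := by
      have e1 : Aᵀ * (A - A * (N * (Aᵀ * A))) = 0 := by
        rw [Matrix.mul_sub, ← Matrix.mul_assoc, ← Matrix.mul_assoc, hMNM, sub_self]
      rw [Matrix.transpose_sub, Matrix.sub_mul, e1, Matrix.transpose_mul, Matrix.mul_assoc, e1,
        Matrix.mul_zero, sub_zero]
    rw [← Matrix.conjTranspose_eq_transpose_of_trivial] at h0
    exact Matrix.conjTranspose_mul_self_eq_zero.mp h0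
  refine ⟨N * Aᵀ, ?_, ?_, ?_, ?_⟩
  · rw [sub_eq_zero] at hz
    simpa only [Matrix.mul_assoc] using hz.symm
  · calc N * Aᵀ * A * (N * Aᵀ) = N * (Aᵀ * A) * N * Aᵀ := by simp only [Matrix.mul_assoc]
      _ = _ := by rw [hNMN]
  · simp [Matrix.transpose_mul, Matrix.mul_assoc, hN]
  · rw [Matrix.mul_assoc, hNM]

/-- The Moore-Penrose inverse is unique. -/
theorem IsMoorePenroseInverse.unique {m n : ℕ} {A : Matrix (Fin m) (Fin n) ℝ}
    {X Y : Matrix (Fin n) (Fin m) ℝ} (hX : IsMoorePenroseInverse A X)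
    (hY : IsMoorePenroseInverse A Y) : X = Y := by
  have h1 : A * X = A * Y := by
    calc A * X = (A * X)ᵀ := hX.symm_left.symm
      _ = ((A * Y) * (A * X))ᵀ := by rw [← Matrix.mul_assoc, hY.mul_mul_self]
      _ = (A * X) * (A * Y) := by rw [Matrix.transpose_mul, hX.symm_left, hY.symm_left]
      _ = A * Y := by rw [← Matrix.mul_assoc, hX.mul_mul_self]
  have h2 : X * A = Y * A := by
    calc X * A = (X * A)ᵀ := hX.symm_right.symm
      _ = ((X * A) * (Y * A))ᵀ := by
          rw [Matrix.mul_assoc X, ← Matrix.mul_assoc A, hY.mul_mul_self]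
      _ = (Y * A) * (X * A) := by rw [Matrix.transpose_mul, hX.symm_right, hY.symm_right]
      _ = Y * A := by rw [Matrix.mul_assoc Y, ← Matrix.mul_assoc A, hX.mul_mul_self]
  calc X = X * A * X := hX.inv_mul_mul.symm
    _ = Y * A * Y := by rw [h2, Matrix.mul_assoc, h1, ← Matrix.mul_assoc]
    _ = Y := hY.inv_mul_mul

/-- The Moore-Penrose inverse `A†` of a real matrix. -/
def pinv {m n : ℕ} (A : Matrix (Fin m) (Fin n) ℝ) : Matrix (Fin n) (Fin m) ℝ :=
  (exists_isMoorePenroseInverse A).choose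

theorem isMoorePenroseInverse_pinv {m n : ℕ} (A : Matrix (Fin m) (Fin n) ℝ) :
    IsMoorePenroseInverse A (pinv A) :=
  (exists_isMoorePenroseInverse A).choose_spec

/-- The column space of `A`, inside Euclidean space. -/
def colSpace {m n : ℕ} (A : Matrix (Fin m) (Fin n) ℝ) :
    Submodule ℝ (EuclideanSpace ℝ (Fin m)) :=
  LinearMap.range (Matrix.toEuclideanLin A)

/-- The `j`-th leverage score of `A`: the squared norm of the `j`-th row of a matrix whose columns
form an orthonormal basis of the column space of `A`. The next two theorems show that it does not
depend on the basis. -/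
def leverageScore {m n : ℕ} (A : Matrix (Fin m) (Fin n) ℝ) (j : Fin m) : ℝ :=
  ∑ k, ((stdOrthonormalBasis ℝ (colSpace A) k : EuclideanSpace ℝ (Fin m)) j) ^ 2

theorem leverageScore_eq_sum_basis {m n : ℕ} (A : Matrix (Fin m) (Fin n) ℝ) (j : Fin m)
    {r : ℕ} (b : OrthonormalBasis (Fin r) ℝ (colSpace A)) :
    leverageScore A j = ∑ k, ((b k : EuclideanSpace ℝ (Fin m)) j) ^ 2 := by
  have key : ∀ {s : ℕ} (c : OrthonormalBasis (Fin s) ℝ (colSpace A)),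
      ∑ k, ((c k : EuclideanSpace ℝ (Fin m)) j) ^ 2
        = ‖(colSpace A).orthogonalProjectionOnto (EuclideanSpace.single j (1 : ℝ))‖ ^ 2 := by
    intro s c
    rw [← c.sum_sq_norm_inner_right]
    refine Finset.sum_congr rfl fun k _ => ?_
    rw [Submodule.inner_orthogonalProjectionOnto_eq_of_mem_left, EuclideanSpace.inner_single_right]
    simp
  rw [leverageScore, key, key]

/-- For any `Q` with orthonormal columns and the same column space as `A`, the leverage scores
of `A` are the squared row norms of `Q`. -/
theorem leverageScore_eq_row_norm_sq {m n r : ℕ} (A : Matrix (Fin m) (Fin n) ℝ)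
    (Q : Matrix (Fin m) (Fin r) ℝ) (hQ : Qᵀ * Q = 1) (hr : colSpace Q = colSpace A)
    (j : Fin m) : leverageScore A j = ‖WithLp.toLp 2 (Q j)‖ ^ 2 := by
  have h1 : leverageScore A j = leverageScore Q j := by
    have h : ∀ S T : Submodule ℝ (EuclideanSpace ℝ (Fin m)), S = T →
        ∑ k, ((stdOrthonormalBasis ℝ S k : EuclideanSpace ℝ (Fin m)) j) ^ 2 =
        ∑ k, ((stdOrthonormalBasis ℝ T k : EuclideanSpace ℝ (Fin m)) j) ^ 2 := by
      rintro S _ rfl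
      rfl
    exact h _ _ hr.symm
  have hiso : ∀ x, ‖Matrix.toEuclideanLin Q x‖ = ‖x‖ := by
    intro x
    have h2 : ‖Matrix.toEuclideanLin Q x‖ ^ 2 = ‖x‖ ^ 2 := by
      rw [← real_inner_self_eq_norm_sq, ← real_inner_self_eq_norm_sq,
        EuclideanSpace.inner_eq_star_dotProduct, EuclideanSpace.inner_eq_star_dotProduct]
      simp only [star_trivial, Matrix.ofLp_toLpLin, Matrix.toLin'_apply]
      rw [Matrix.dotProduct_mulVec, ← Matrix.mulVec_transpose, Matrix.mulVec_mulVec, hQ,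
        Matrix.one_mulVec]
    exact (sq_eq_sq₀ (norm_nonneg _) (norm_nonneg _)).mp h2
  let f : EuclideanSpace ℝ (Fin r) →ₗᵢ[ℝ] EuclideanSpace ℝ (Fin m) :=
    ⟨Matrix.toEuclideanLin Q, hiso⟩
  let b : OrthonormalBasis (Fin r) ℝ (colSpace Q) := OrthonormalBasis.ofRepr f.equivRange.symm
  have hb : ∀ k, ((b k : EuclideanSpace ℝ (Fin m)) j) = Q j k := by
    intro k
    have : (b k : EuclideanSpace ℝ (Fin m)) =
        Matrix.toEuclideanLin Q (EuclideanSpace.single k (1 : ℝ)) := by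
      rw [← b.repr_symm_single k]
      rfl
    rw [this]
    simp [Matrix.toEuclideanLin]
  rw [h1, leverageScore_eq_sum_basis Q j b, EuclideanSpace.real_norm_sq_eq]
  simp only [hb]

/-- The two-norm condition number with respect to left inversion, `‖A‖₂ ‖A†‖₂`. -/
def condNumber {m n : ℕ} (A : Matrix (Fin m) (Fin n) ℝ) : ℝ := ‖A‖ * ‖pinv A‖

/-- The relative size `‖ΔA‖₂ / ‖A‖₂` of the perturbation. -/
def relPert {m n : ℕ} (A ΔA : Matrix (Fin m) (Fin n) ℝ) : ℝ := ‖ΔA‖ / ‖A‖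

/-- The relative size `‖(I - A A†) ΔA‖₂ / ‖A‖₂` of the projected perturbation. -/
def relProjPert {m n : ℕ} (A ΔA : Matrix (Fin m) (Fin n) ℝ) : ℝ :=
  ‖(1 - A * pinv A) * ΔA‖ / ‖A‖

end

open scoped RealInnerProductSpace

/-! ### Orthogonal projections and the gap between two subspaces. -/

section Projections

variable {E : Type*} [NormedAddCommGroup E] [InnerProductSpace ℝ E] [FiniteDimensional ℝ E]

/-! A leverage score is `‖P_U e_j‖²`, with `P_U` the orthogonal projection onto the column space `U`
of `A`, so the theorem compares projections of `e_j` onto `U` and onto the column space `V` of `A +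
ΔA`. If `σ` bounds the gap between `U` and `V` in both directions, splitting `e_j` along `U` and its
complement bounds the change by `2σ√(ℓ(1-ℓ)) + σ²` (`abs_norm_sq_starProjection_sub_le`). Each
estimate of the theorem comes from a one-sided gap: `σ = κ ε` from `U` to `V` (`colSpace_gap_le`),
and `σ = 2 κ ε^⊥` from `V` to `U` (`colSpace_add_gap_le`). The rank is preserved, so `U` and `V`
have equal dimension and `gap_le_of_gap_le` supplies the other direction. -/

theorem norm_sq_eq_starProjection_add_sub (U : Submodule ℝ E) (x : E) :
    ‖x‖ ^ 2 = ‖U.starProjection x‖ ^ 2 + ‖x - U.starProjection x‖ ^ 2 := by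
  rw [U.norm_sq_eq_add_norm_sq_starProjection x, Submodule.starProjection_orthogonal_val]

theorem inner_starProjection_self (U : Submodule ℝ E) (x y : E) :
    ⟪x, U.starProjection y⟫ = ⟪U.starProjection x, U.starProjection y⟫ := by
  rw [U.inner_starProjection_left_eq_right x,
    (Submodule.starProjection_eq_self_iff).2 (U.starProjection_apply_mem y)]

theorem norm_sub_starProjection_le_of_mem (U : Submodule ℝ E) (x : E) {w : E} (hw : w ∈ U) :
    ‖x - U.starProjection x‖ ≤ ‖x - w‖ := by
  rw [U.starProjection_minimal x]
  exact ciInf_le ⟨0, by rintro _ ⟨y, rfl⟩; positivity⟩ (⟨w, hw⟩ : U)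

/-- For subspaces of equal dimension, the two one-sided gaps agree. -/
theorem gap_le_of_gap_le {U V : Submodule ℝ E}
    (hd : Module.finrank ℝ V = Module.finrank ℝ U) {σ : ℝ} (hσ : 0 ≤ σ)
    (h : ∀ v ∈ V, ‖v - U.starProjection v‖ ≤ σ * ‖v‖) :
    ∀ u ∈ U, ‖u - V.starProjection u‖ ≤ σ * ‖u‖ := by
  intro u hu
  rcases le_or_gt 1 σ with h1 | h1
  · have := norm_sub_starProjection_le_of_mem V u V.zero_mem
    rw [sub_zero] at this
    nlinarith [norm_nonneg u]
  have hc : 0 < 1 - σ ^ 2 := by nlinarith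
  have hlow : ∀ v ∈ V, (1 - σ ^ 2) * ‖v‖ ^ 2 ≤ ‖U.starProjection v‖ ^ 2 := by
    intro v hv
    have h2 := norm_sq_eq_starProjection_add_sub U v
    have h3 := pow_le_pow_left₀ (norm_nonneg _) (h v hv) 2
    nlinarith
  let f : V →ₗ[ℝ] U := U.orthogonalProjectionOnto.toLinearMap ∘ₗ V.subtype
  have hinj : Function.Injective f := by
    rw [← LinearMap.ker_eq_bot, LinearMap.ker_eq_bot']
    intro v hv
    have h2 := hlow v v.2
    have h3 : U.starProjection (v : E) = 0 := by
      rw [← Submodule.coe_orthogonalProjectionOnto_apply]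
      exact congrArg Subtype.val hv
    rw [h3, norm_zero] at h2
    have h4 : ‖(v : E)‖ ^ 2 ≤ 0 := by nlinarith [sq_nonneg ‖(v : E)‖]
    have h5 : ‖(v : E)‖ = 0 := by
      have := le_antisymm h4 (sq_nonneg _)
      simpa using this
    exact Subtype.ext (norm_eq_zero.1 h5)
  -- For `σ < 1` the projection `V → U` is injective, hence onto by equality of dimensions: `u = P_U
  -- v`.
  obtain ⟨v, hv⟩ := (LinearMap.injective_iff_surjective_of_finrank_eq_finrank hd).1 hinj ⟨u, hu⟩
  have hvu : U.starProjection (v : E) = u := by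
    rw [← Submodule.coe_orthogonalProjectionOnto_apply]
    exact congrArg Subtype.val hv
  have h2 := hlow v v.2
  rw [hvu] at h2
  have h3 : ‖u‖ ^ 2 ≤ ‖V.starProjection u‖ * ‖(v : E)‖ := by
    calc ‖u‖ ^ 2 = ⟪u, (v : E)⟫ := by
          rw [← real_inner_self_eq_norm_sq]
          nth_rewrite 2 [← hvu]
          rw [← U.inner_starProjection_left_eq_right, (Submodule.starProjection_eq_self_iff).2 hu]
      _ = ⟪V.starProjection u, (v : E)⟫ := by
          rw [V.inner_starProjection_left_eq_right, (Submodule.starProjection_eq_self_iff).2 v.2]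
      _ ≤ _ := real_inner_le_norm _ _
  have h4 : (1 - σ ^ 2) * ‖u‖ ^ 2 ≤ ‖V.starProjection u‖ ^ 2 := by
    rcases (sq_nonneg ‖u‖).eq_or_lt with h0 | h0
    · rw [← h0, mul_zero]; positivity
    -- Combine `‖u‖⁴ ≤ ‖P_V u‖² ‖v‖²` with `(1 - σ²) ‖v‖² ≤ ‖u‖²` and cancel `‖u‖²`.
    · refine le_of_mul_le_mul_right ?_ h0
      have h5 := pow_le_pow_left₀ (sq_nonneg _) h3 2
      nlinarith [mul_le_mul_of_nonneg_left h2 (sq_nonneg ‖V.starProjection u‖),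
        mul_le_mul_of_nonneg_left h5 hc.le]
  have h5 := norm_sq_eq_starProjection_add_sub V u
  refine le_of_sq_le_sq ?_ (by positivity)
  nlinarith

/-- Duality: `P_V` on the complement of `U` is adjoint to `1 - P_U` on `V`, so it inherits the bound
`σ`. -/
theorem norm_starProjection_le_of_gap_le {U V : Submodule ℝ E} {σ : ℝ} (hσ : 0 ≤ σ)
    (h : ∀ v ∈ V, ‖v - U.starProjection v‖ ≤ σ * ‖v‖) {b : E} (hb : U.starProjection b = 0) :
    ‖V.starProjection b‖ ≤ σ * ‖b‖ := by
  have h1 : ‖V.starProjection b‖ ^ 2 ≤ σ * ‖V.starProjection b‖ * ‖b‖ := by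
    set w := V.starProjection b with hw
    calc ‖w‖ ^ 2 = ⟪w, b⟫ := by
          rw [← real_inner_self_eq_norm_sq, real_inner_comm b w, hw,
            inner_starProjection_self V b b]
      _ = ⟪w - U.starProjection w, b⟫ := by
          rw [inner_sub_left, U.inner_starProjection_left_eq_right, hb, inner_zero_right, sub_zero]
      _ ≤ ‖w - U.starProjection w‖ * ‖b‖ := real_inner_le_norm _ _
      _ ≤ _ := mul_le_mul_of_nonneg_right (h w (V.starProjection_apply_mem b)) (norm_nonneg _)
  rcases (norm_nonneg (V.starProjection b)).eq_or_lt with h0 | h0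
  · rw [← h0]; positivity
  · refine le_of_mul_le_mul_left ?_ h0
    nlinarith

/-- The squared lengths of the projections of `x` to two subspaces, in terms of their gap. -/
theorem abs_norm_sq_starProjection_sub_le {U V : Submodule ℝ E} {σ : ℝ} (hσ : 0 ≤ σ)
    (hUV : ∀ u ∈ U, ‖u - V.starProjection u‖ ≤ σ * ‖u‖)
    (hVU : ∀ v ∈ V, ‖v - U.starProjection v‖ ≤ σ * ‖v‖) (x : E) :
    |‖V.starProjection x‖ ^ 2 - ‖U.starProjection x‖ ^ 2| ≤
      2 * σ * (‖U.starProjection x‖ * ‖x - U.starProjection x‖) + σ ^ 2 * ‖x‖ ^ 2 := by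
  have hx := norm_sq_eq_starProjection_add_sub U x
  have haU := U.starProjection_apply_mem x
  set a := U.starProjection x with ha
  set b := x - a with hb
  have hxab : x = a + b := by rw [hb]; abel
  have hUb : U.starProjection b = 0 := by
    rw [hb, map_sub, (Submodule.starProjection_eq_self_iff).2 haU, ← ha, sub_self]
  have h1 := pow_le_pow_left₀ (norm_nonneg _) (hUV a haU) 2
  have hVb := norm_starProjection_le_of_gap_le hσ hVU hUb
  have h2 := pow_le_pow_left₀ (norm_nonneg _) hVb 2
  have h3 := norm_sq_eq_starProjection_add_sub V a
  have h4 : ‖V.starProjection x‖ ^ 2 = ‖V.starProjection a‖ ^ 2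
      + 2 * ⟪a, V.starProjection b⟫ + ‖V.starProjection b‖ ^ 2 := by
    rw [hxab, map_add, norm_add_sq_real, inner_starProjection_self V a b]
  have h5 : |⟪a, V.starProjection b⟫| ≤ ‖a‖ * (σ * ‖b‖) :=
    (abs_real_inner_le_norm _ _).trans (mul_le_mul_of_nonneg_left hVb (norm_nonneg _))
  obtain ⟨h6, h7⟩ := abs_le.1 h5
  -- By `h3` the difference is `2⟪a, P_V b⟫ + ‖P_V b‖² - ‖a - P_V a‖²`; the two squares are at most
  -- `σ²‖b‖²` and `σ²‖a‖²`, and `‖a‖² + ‖b‖² = ‖x‖²`.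
  rw [abs_le, h4]
  constructor <;> nlinarith [sq_nonneg (σ * ‖a‖), sq_nonneg (σ * ‖b‖),
    sq_nonneg ‖a - V.starProjection a‖, sq_nonneg ‖V.starProjection b‖]

end Projections

/-! ### Column spaces, their gaps, and leverage scores. -/

section Matrices

variable {m n : ℕ}

theorem norm_toEuclideanLin_le (A : Matrix (Fin m) (Fin n) ℝ) (x : EuclideanSpace ℝ (Fin n)) :
    ‖Matrix.toEuclideanLin A x‖ ≤ ‖A‖ * ‖x‖ :=
  Matrix.l2_opNorm_mulVec A x

theorem toEuclideanLin_mul_apply {l : ℕ} (A : Matrix (Fin m) (Fin n) ℝ)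
    (B : Matrix (Fin n) (Fin l) ℝ) (x : EuclideanSpace ℝ (Fin l)) :
    Matrix.toEuclideanLin (A * B) x = Matrix.toEuclideanLin A (Matrix.toEuclideanLin B x) := by
  simp [Matrix.toLpLin_apply, Matrix.mulVec_mulVec]

theorem finrank_colSpace (A : Matrix (Fin m) (Fin n) ℝ) :
    Module.finrank ℝ (colSpace A) = A.rank := by
  rw [colSpace, Matrix.toEuclideanLin, Matrix.toLpLin_eq_toLin, ← Matrix.rank_eq_finrank_range_toLin]

theorem rank_eq_iff_injective (A : Matrix (Fin m) (Fin n) ℝ) :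
    A.rank = n ↔ Function.Injective (Matrix.toEuclideanLin A) := by
  have h := LinearMap.finrank_range_add_finrank_ker (Matrix.toEuclideanLin A)
  rw [finrank_euclideanSpace_fin] at h
  rw [← LinearMap.ker_eq_bot, ← finrank_colSpace, colSpace, ← Submodule.finrank_eq_zero]
  omega

theorem leverageScore_eq_norm_sq_starProjection (A : Matrix (Fin m) (Fin n) ℝ) (j : Fin m) :
    leverageScore A j =
      ‖(colSpace A).starProjection (EuclideanSpace.single j (1 : ℝ))‖ ^ 2 := by
  rw [← Submodule.coe_orthogonalProjectionOnto_apply, Submodule.norm_coe, leverageScore,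
    ← (stdOrthonormalBasis ℝ (colSpace A)).sum_sq_norm_inner_right]
  refine Finset.sum_congr rfl fun k _ => ?_
  rw [Submodule.inner_orthogonalProjectionOnto_eq_of_mem_left, EuclideanSpace.inner_single_right]
  simp

theorem toEuclideanLin_pinv_apply_of_injective {A : Matrix (Fin m) (Fin n) ℝ}
    (hA : Function.Injective (Matrix.toEuclideanLin A)) (y : EuclideanSpace ℝ (Fin n)) :
    Matrix.toEuclideanLin (pinv A) (Matrix.toEuclideanLin A y) = y := by
  apply hA
  rw [← toEuclideanLin_mul_apply, ← toEuclideanLin_mul_apply,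
    (isMoorePenroseInverse_pinv A).mul_mul_self]

theorem toEuclideanLin_mul_pinv_apply_of_mem {A : Matrix (Fin m) (Fin n) ℝ}
    {u : EuclideanSpace ℝ (Fin m)} (hu : u ∈ colSpace A) :
    Matrix.toEuclideanLin A (Matrix.toEuclideanLin (pinv A) u) = u := by
  obtain ⟨y, rfl⟩ := hu
  rw [← toEuclideanLin_mul_apply, ← toEuclideanLin_mul_apply,
    (isMoorePenroseInverse_pinv A).mul_mul_self]

/-- Write `y = A†(A + ΔA)y - A†ΔA y`; the last term has norm at most `‖y‖/2` and is absorbed on the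
left. This gives both the rank claim and the factor 2 in the projected gap. -/
theorem norm_le_norm_toEuclideanLin_add {A ΔA : Matrix (Fin m) (Fin n) ℝ}
    (hA : Function.Injective (Matrix.toEuclideanLin A)) (hΔ : ‖ΔA‖ * ‖pinv A‖ ≤ 1 / 2)
    (y : EuclideanSpace ℝ (Fin n)) :
    ‖y‖ ≤ 2 * ‖pinv A‖ * ‖Matrix.toEuclideanLin (A + ΔA) y‖ := by
  have h1 : y = Matrix.toEuclideanLin (pinv A) (Matrix.toEuclideanLin (A + ΔA) y)
      - Matrix.toEuclideanLin (pinv A) (Matrix.toEuclideanLin ΔA y) := by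
    rw [map_add, LinearMap.add_apply, map_add, toEuclideanLin_pinv_apply_of_injective hA]
    abel
  have h2 := norm_sub_le (Matrix.toEuclideanLin (pinv A) (Matrix.toEuclideanLin (A + ΔA) y))
    (Matrix.toEuclideanLin (pinv A) (Matrix.toEuclideanLin ΔA y))
  rw [← h1] at h2
  have h3 := norm_toEuclideanLin_le (pinv A) (Matrix.toEuclideanLin (A + ΔA) y)
  have h4 := norm_toEuclideanLin_le (pinv A) (Matrix.toEuclideanLin ΔA y)
  have h5 := mul_le_mul_of_nonneg_left (norm_toEuclideanLin_le ΔA y) (norm_nonneg (pinv A))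
  nlinarith [mul_le_mul_of_nonneg_right hΔ (norm_nonneg y)]

theorem colSpace_gap_le (A ΔA : Matrix (Fin m) (Fin n) ℝ) :
    ∀ u ∈ colSpace A, ‖u - (colSpace (A + ΔA)).starProjection u‖ ≤ ‖pinv A‖ * ‖ΔA‖ * ‖u‖ := by
  intro u hu
  set y := Matrix.toEuclideanLin (pinv A) u with hy
  have h1 : u - Matrix.toEuclideanLin (A + ΔA) y = -Matrix.toEuclideanLin ΔA y := by
    rw [map_add, LinearMap.add_apply, hy, toEuclideanLin_mul_pinv_apply_of_mem hu]
    abel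
  calc ‖u - (colSpace (A + ΔA)).starProjection u‖
      ≤ ‖u - Matrix.toEuclideanLin (A + ΔA) y‖ :=
        norm_sub_starProjection_le_of_mem _ _ (LinearMap.mem_range_self _ y)
    _ = ‖Matrix.toEuclideanLin ΔA y‖ := by rw [h1, norm_neg]
    _ ≤ ‖ΔA‖ * (‖pinv A‖ * ‖u‖) := (norm_toEuclideanLin_le ΔA y).trans
        (mul_le_mul_of_nonneg_left (norm_toEuclideanLin_le _ u) (norm_nonneg _))
    _ = _ := by ring

theorem colSpace_add_gap_le {A ΔA : Matrix (Fin m) (Fin n) ℝ}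
    (hA : Function.Injective (Matrix.toEuclideanLin A)) (hΔ : ‖ΔA‖ * ‖pinv A‖ ≤ 1 / 2) :
    ∀ v ∈ colSpace (A + ΔA), ‖v - (colSpace A).starProjection v‖ ≤
      2 * (‖pinv A‖ * ‖(1 - A * pinv A) * ΔA‖) * ‖v‖ := by
  rintro _ ⟨y, rfl⟩
  set v := Matrix.toEuclideanLin (A + ΔA) y with hv
  -- `I - A A†` annihilates `A`, so only the projected part of `ΔA` survives.
  have h1 : v - Matrix.toEuclideanLin A (Matrix.toEuclideanLin (pinv A) v)
      = Matrix.toEuclideanLin ((1 - A * pinv A) * ΔA) y := by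
    have e : (1 - A * pinv A) * ΔA = (A + ΔA) - A * (pinv A * (A + ΔA)) := by
      have := (isMoorePenroseInverse_pinv A).mul_mul_self
      rw [Matrix.mul_add, Matrix.mul_add, ← Matrix.mul_assoc, this, Matrix.sub_mul,
        Matrix.one_mul, Matrix.mul_assoc]
      abel
    rw [e, map_sub, LinearMap.sub_apply, toEuclideanLin_mul_apply, toEuclideanLin_mul_apply]
  calc ‖v - (colSpace A).starProjection v‖
      ≤ ‖v - Matrix.toEuclideanLin A (Matrix.toEuclideanLin (pinv A) v)‖ :=
        norm_sub_starProjection_le_of_mem _ _ (LinearMap.mem_range_self _ _)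
    _ ≤ ‖(1 - A * pinv A) * ΔA‖ * (2 * ‖pinv A‖ * ‖v‖) := by
        rw [h1]
        exact (norm_toEuclideanLin_le _ y).trans (mul_le_mul_of_nonneg_left
          (norm_le_norm_toEuclideanLin_add hA hΔ y) (norm_nonneg _))
    _ = _ := by ring

/-- Relative leverage score change in terms of the gap of the column spaces. -/
theorem leverageScore_sub_div_le {A B : Matrix (Fin m) (Fin n) ℝ} {σ : ℝ} (hσ : 0 ≤ σ)
    (hAB : ∀ u ∈ colSpace A, ‖u - (colSpace B).starProjection u‖ ≤ σ * ‖u‖)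
    (hBA : ∀ v ∈ colSpace B, ‖v - (colSpace A).starProjection v‖ ≤ σ * ‖v‖)
    {j : Fin m} (hj : 0 < leverageScore A j) :
    |leverageScore B j - leverageScore A j| / leverageScore A j ≤
      2 * σ * Real.sqrt ((1 - leverageScore A j) / leverageScore A j)
        + σ ^ 2 / leverageScore A j := by
  have h1 := abs_norm_sq_starProjection_sub_le hσ hAB hBA (EuclideanSpace.single j (1 : ℝ))
  have h2 := norm_sq_eq_starProjection_add_sub (colSpace A) (EuclideanSpace.single j (1 : ℝ))
  have h3 : ‖(EuclideanSpace.single j (1 : ℝ) : EuclideanSpace ℝ (Fin m))‖ = 1 := by simp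
  rw [h3] at h1 h2
  rw [← leverageScore_eq_norm_sq_starProjection, ← leverageScore_eq_norm_sq_starProjection] at h1
  have hl := leverageScore_eq_norm_sq_starProjection A j
  set p := ‖(colSpace A).starProjection (EuclideanSpace.single j (1 : ℝ))‖
  set q := ‖EuclideanSpace.single j (1 : ℝ)
    - (colSpace A).starProjection (EuclideanSpace.single j (1 : ℝ))‖
  have hp : 0 ≤ p := norm_nonneg _
  have hq : 0 ≤ q := norm_nonneg _
  have hp' : 0 < p := by
    refine hp.lt_of_ne fun h => ?_
    rw [hl, ← h] at hj
    norm_num at hj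
  -- Pythagoras for the unit vector `e_j`: `p² = ℓ` and `q² = 1 - ℓ`.
  have h4 : (1 - leverageScore A j) / leverageScore A j = (q / p) ^ 2 := by
    rw [hl, div_pow]
    congr 1
    linarith
  rw [h4, Real.sqrt_sq (by positivity), div_le_iff₀ hj]
  refine h1.trans (le_of_eq ?_)
  rw [hl]
  field_simp

end Matrices

/-- Relative leverage score perturbation bounds; `‖·‖` is the spectral norm of a matrix. -/
theorem mainTheorem3 (m n : ℕ) (A ΔA : Matrix (Fin m) (Fin n) ℝ)
    (hA : A.rank = n) (hΔ : ‖ΔA‖ * ‖pinv A‖ ≤ 1 / 2) :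
    (A + ΔA).rank = n ∧
    ∀ j : Fin m, 0 < leverageScore A j →
      |leverageScore (A + ΔA) j - leverageScore A j| / leverageScore A j
          ≤ 4 * (Real.sqrt ((1 - leverageScore A j) / leverageScore A j)
              + condNumber A / leverageScore A j * relProjPert A ΔA)
            * condNumber A * relProjPert A ΔA ∧
      |leverageScore (A + ΔA) j - leverageScore A j| / leverageScore A j
          ≤ (2 * Real.sqrt ((1 - leverageScore A j) / leverageScore A j)
              + condNumber A / leverageScore A j * relPert A ΔA)
            * condNumber A * relPert A ΔA := by
  have hinj := (rank_eq_iff_injective A).1 hA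
  have hB : (A + ΔA).rank = n := by
    rw [rank_eq_iff_injective, injective_iff_map_eq_zero]
    intro y hy
    have h := norm_le_norm_toEuclideanLin_add hinj hΔ y
    rw [hy, norm_zero, mul_zero] at h
    exact norm_le_zero_iff.1 h
  have hd : Module.finrank ℝ (colSpace (A + ΔA)) = Module.finrank ℝ (colSpace A) := by
    rw [finrank_colSpace, finrank_colSpace, hA, hB]
  refine ⟨hB, fun j hj => ?_⟩
  -- Needed to cancel `‖A‖` between the condition number and the relative perturbation; `A = 0`
  -- would force `ℓ = 0`.
  have hA0 : ‖A‖ ≠ 0 := by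
    intro h
    have h0 : A = 0 := norm_eq_zero.1 h
    have h1 : colSpace A = ⊥ := by rw [colSpace, h0, map_zero, LinearMap.range_zero]
    rw [leverageScore_eq_norm_sq_starProjection, h1] at hj
    simp at hj
  constructor
  · have e : condNumber A * relProjPert A ΔA = ‖pinv A‖ * ‖(1 - A * pinv A) * ΔA‖ := by
      rw [condNumber, relProjPert]
      field_simp
    have h := colSpace_add_gap_le hinj hΔ
    have h' := gap_le_of_gap_le hd (by positivity) h
    refine (leverageScore_sub_div_le (by positivity) h' h hj).trans (le_of_eq ?_)
    rw [← e]
    ring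
  · have e : condNumber A * relPert A ΔA = ‖pinv A‖ * ‖ΔA‖ := by
      rw [condNumber, relPert]
      field_simp
    have h := colSpace_gap_le A ΔA
    have h' := gap_le_of_gap_le hd.symm (by positivity) h
    refine (leverageScore_sub_div_le (by positivity) h h' hj).trans (le_of_eq ?_)
    rw [← e]
    ring
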